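/- Let $-1<a<1$ and let $P(x,\cdot)=\mathcal N(ax,1)$ be the AR(1) transition kernel on $\mathbb R$. Let $(U_t)_{t\ge1}$ be a stationary AR(1) process: $U_1$ has a law $\pi$ that is invariant under $P$, and $U_t=aU_{t-1}+\zeta_t$ for $t\ge2$, where the $\zeta_t$ are i.i.d. $\mathcal N(0,1)$ and independent of $U_1$. Let $\gamma_{ps}$ be the pseudo-spectral gap of the chain, $$\gamma_{ps}=\max_{k\ge1}\frac{\gamma\big((P^*)^kP^k\big)}{k},\qquad \gamma(T)=1-\sup\{\lambda\in\mathrm{sp}(T):\lambda\ne1\},$$ where $P$ acts on the complex Hilbert space $L^2(\pi)$ by $(Pf)(u)=\int f(v)\,P(u,dv)$, $P^*$ is its adjoint, and $\mathrm{sp}(T)$ is the spectrum of the self-adjoint operator $T$ on $L^2(\pi)$. For $n\ge1$ put $$\widehat\gamma_{ps}=\min\left\{\frac{1}{\frac1n\sum_{t=1}^nU_t^2},\,1\right\}.$$ Then $\gamma_{ps}>0$; for every $\varepsilon>0$, $$\mathbb P\left(\left|\frac{\widehat\gamma_{ps}}{\gamma_{ps}}-1\right|\le\varepsilon\right)\ \ge\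 1-\exp\left(\frac94-\frac{n\varepsilon^2\gamma_{ps}^3}{2304}\right);$$ and, in other words, for every $\delta\in(0,1)$, $$\mathbb P\left(\left|\frac{\widehat\gamma_{ps}}{\gamma_{ps}}-1\right|\le\frac{24}{\gamma_{ps}^{3/2}}\sqrt{\frac{9+4\log(1/\delta)}{n}}\right)\ \ge\ 1-\delta.$$ -/

import Mathlib

open MeasureTheory ProbabilityTheory

noncomputable section

namespace MarkovL2

variable {α : Type*} [MeasurableSpace α]

/-- Jensen's inequality and invariance: `P` does not increase the `L²(π)` norm. -/
theorem eLpNorm_integral_le (P : Kernel α α) [IsMarkovKernel P] {π : Measure α}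
    (hπ : P.Invariant π) {f : α → ℂ} (hf : StronglyMeasurable f) :
    eLpNorm (fun u => ∫ v, f v ∂(P u)) 2 π ≤ eLpNorm f 2 π := by
  have key : ∀ u, ‖∫ v, f v ∂(P u)‖ₑ ^ (2 : ℝ) ≤ ∫⁻ v, ‖f v‖ₑ ^ (2 : ℝ) ∂(P u) := by
    intro u
    have h1 : ‖∫ v, f v ∂(P u)‖ₑ ≤ eLpNorm f 2 (P u) := by
      refine (enorm_integral_le_lintegral_enorm f).trans ?_
      rw [← eLpNorm_one_eq_lintegral_enorm]
      exact eLpNorm_le_eLpNorm_of_exponent_le (by norm_num) hf.aestronglyMeasurable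
    have h2 : eLpNorm f 2 (P u) ^ (2 : ℝ) = ∫⁻ v, ‖f v‖ₑ ^ (2 : ℝ) ∂(P u) := by
      rw [eLpNorm_eq_lintegral_rpow_enorm_toReal (by norm_num) (by norm_num)]
      rw [← ENNReal.rpow_mul]
      simp
    rw [← h2]
    gcongr
  rw [eLpNorm_eq_lintegral_rpow_enorm_toReal (by norm_num) (by norm_num),
    eLpNorm_eq_lintegral_rpow_enorm_toReal (by norm_num) (by norm_num)]
  refine ENNReal.rpow_le_rpow ?_ (by positivity)
  simp only [ENNReal.toReal_ofNat]
  calc ∫⁻ u, ‖∫ v, f v ∂(P u)‖ₑ ^ (2 : ℝ) ∂π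
      ≤ ∫⁻ u, ∫⁻ v, ‖f v‖ₑ ^ (2 : ℝ) ∂(P u) ∂π := lintegral_mono key
    _ = ∫⁻ v, ‖f v‖ₑ ^ (2 : ℝ) ∂(π.bind P) :=
        (Measure.lintegral_bind P.aemeasurable (by fun_prop)).symm
    _ = ∫⁻ v, ‖f v‖ₑ ^ (2 : ℝ) ∂π := by rw [hπ.def]

theorem memLp_integral (P : Kernel α α) [IsMarkovKernel P] {π : Measure α}
    (hπ : P.Invariant π) (f : Lp ℂ 2 π) :
    MemLp (fun u => ∫ v, f v ∂(P u)) 2 π :=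
  ⟨(Lp.stronglyMeasurable f).integral_kernel.aestronglyMeasurable,
    (eLpNorm_integral_le P hπ (Lp.stronglyMeasurable f)).trans_lt (Lp.eLpNorm_lt_top f)⟩

theorem ae_ae_of_ae (P : Kernel α α) {π : Measure α} (hπ : P.Invariant π) {p : α → Prop}
    (h : ∀ᵐ v ∂π, p v) : ∀ᵐ u ∂π, ∀ᵐ v ∂(P u), p v :=
  Measure.ae_ae_of_ae_bind P.aemeasurable (by rw [hπ.def]; exact h)

theorem ae_integrable (P : Kernel α α) [IsMarkovKernel P] {π : Measure α}
    (hπ : P.Invariant π) (f : Lp ℂ 2 π) : ∀ᵐ u ∂π, Integrable f (P u) := by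
  have h : ∫⁻ u, ∫⁻ v, ‖f v‖ₑ ^ (2 : ℝ) ∂(P u) ∂π ≠ ⊤ := by
    have hm := Lp.stronglyMeasurable f
    rw [← Measure.lintegral_bind P.aemeasurable (by fun_prop), hπ.def]
    exact (lintegral_rpow_enorm_lt_top_of_eLpNorm_lt_top (p := 2) (by norm_num) (by norm_num)
      (Lp.eLpNorm_lt_top f)).ne
  have hm := Lp.stronglyMeasurable f
  have hmeas : Measurable fun u => ∫⁻ v, ‖f v‖ₑ ^ (2 : ℝ) ∂(P u) :=
    Measurable.lintegral_kernel (by fun_prop)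
  filter_upwards [ae_lt_top hmeas h] with u hu
  have : MemLp f 2 (P u) := by
    refine ⟨hm.aestronglyMeasurable, ?_⟩
    exact (eLpNorm_lt_top_iff_lintegral_rpow_enorm_lt_top (by norm_num) (by norm_num)).2
      (by simpa using hu)
  exact this.integrable (by norm_num)

/-- The operator `(P f)(u) = ∫ f(v) P(u, dv)` on the complex Hilbert space `L²(π)`, for a
Markov kernel `P` with invariant measure `π`. -/
def markovOp (P : Kernel α α) [IsMarkovKernel P] (π : Measure α) (hπ : P.Invariant π) :
    Lp ℂ 2 π →L[ℂ] Lp ℂ 2 π :=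
  LinearMap.mkContinuous
    { toFun := fun f => (memLp_integral P hπ f).toLp (fun u => ∫ v, f v ∂(P u))
      map_add' := by
        intro f g
        rw [← MemLp.toLp_add]
        refine MemLp.toLp_congr _ _ ?_
        filter_upwards [ae_ae_of_ae P hπ (Lp.coeFn_add f g), ae_integrable P hπ f,
          ae_integrable P hπ g] with u hu hf hg
        rw [integral_congr_ae hu]
        exact integral_add hf hg
      map_smul' := by
        intro c f
        rw [RingHom.id_apply, ← MemLp.toLp_const_smul]
        refine MemLp.toLp_congr _ _ ?_
        filter_upwards [ae_ae_of_ae P hπ (Lp.coeFn_smul c f)] with u hu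
        rw [integral_congr_ae hu]
        exact integral_smul c f }
    1
    (by
      intro f
      rw [one_mul, LinearMap.coe_mk, AddHom.coe_mk, Lp.norm_toLp, Lp.norm_def]
      exact ENNReal.toReal_mono (Lp.eLpNorm_ne_top f)
        (eLpNorm_integral_le P hπ (Lp.stronglyMeasurable f)))

/-- The spectral gap `1 - sup {λ ∈ sp(T) : λ ≠ 1}` of a self-adjoint operator `T` on a complex
Hilbert space, whose spectrum is real. When `T` is positive, as below, it makes no difference
whether `0` is counted in the spectrum (the supremum is `0` if no other value is left). -/
def spectralGap {H : Type*} [NormedAddCommGroup H] [InnerProductSpace ℂ H] (T : H →L[ℂ] H) : ℝ :=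
  1 - sSup {x : ℝ | (x : ℂ) ∈ spectrum ℂ T ∧ x ≠ 1}

/-- The pseudo-spectral gap `max_{k ≥ 1} γ((P*)ᵏ Pᵏ) / k`, where `P*` is the adjoint of `P` in
`L²(π)`, that is, the operator of the time-reversed kernel. -/
def pseudoSpectralGap (P : Kernel α α) [IsMarkovKernel P] (π : Measure α)
    (hπ : P.Invariant π) : ℝ :=
  ⨆ k : ℕ+, spectralGap
    (ContinuousLinearMap.adjoint (markovOp P π hπ) ^ (k : ℕ) * markovOp P π hπ ^ (k : ℕ)) / (k : ℝ)

end MarkovL2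

namespace AR1

theorem measurable_gaussian (a : ℝ) : Measurable fun x : ℝ => gaussianReal (a * x) 1 := by
  exact measurable_gaussianReal.comp
    (by fun_prop : Measurable fun x : ℝ => (a * x, (1 : NNReal)))

/-- The AR(1) transition kernel `P(x, ·) = N(a x, 1)`. -/
def kernel (a : ℝ) : Kernel ℝ ℝ where
  toFun x := gaussianReal (a * x) 1
  measurable' := measurable_gaussian a

instance (a : ℝ) : IsMarkovKernel (kernel a) :=
  ⟨fun x => inferInstanceAs (IsProbabilityMeasure (gaussianReal (a * x) 1))⟩

/-- `(U t)_{t ≥ 1}` is the AR(1) chain `U (t + 1) = a * U t + ζ (t + 1)` with i.i.d. standard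
Gaussian innovations `(ζ t)_{t ≥ 2}`, independent of the initial value `U 1`, whose law is `π`.
The values `U 0`, `ζ 0`, `ζ 1` play no role. -/
structure IsChain {Ω : Type*} [MeasurableSpace Ω] (μ : Measure Ω) (a : ℝ) (π : Measure ℝ)
    (U ζ : ℕ → Ω → ℝ) : Prop where
  measurable_U : ∀ t, 1 ≤ t → Measurable (U t)
  measurable_noise : ∀ t, 2 ≤ t → Measurable (ζ t)
  law_init : μ.map (U 1) = π
  law_noise : ∀ t, 2 ≤ t → μ.map (ζ t) = gaussianReal 0 1
  indep_noise : iIndepFun (fun t : {t : ℕ // 2 ≤ t} => ζ t) μ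
  indep_init : IndepFun (U 1) (fun ω (t : {t : ℕ // 2 ≤ t}) => ζ t ω) μ
  recursion : ∀ t, 1 ≤ t → ∀ᵐ ω ∂μ, U (t + 1) ω = a * U t ω + ζ (t + 1) ω

/-- The estimator `min {1 / ((1/n) ∑_{t=1}^n (x t)²), 1}`. -/
def gapEstimator (n : ℕ) (x : ℕ → ℝ) : ℝ :=
  min (1 / ((1 / (n : ℝ)) * ∑ t ∈ Finset.Icc 1 n, x t ^ 2)) 1

end AR1

end

/-! Write `γ = 1 - a ^ 2`. The proof has two independent halves.

Spectral half: the pseudo-spectral gap equals `γ` (`pseudoSpectralGap_kernel`). The invariant law is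
the Gaussian of variance `1 / γ` and the chain is reversible, so `P` is self-adjoint. The function
`u ↦ u` is an eigenvector for `a`, which bounds the `k`-th gap by `1 - a ^ (2 * k) ≤ k * γ`.
Conversely `P` multiplies Lipschitz constants by `|a|`, so smooth compactly supported functions
converge to their mean at rate `|a| ^ k`. For a self-adjoint operator such a rate on a dense set
already bounds the norm off the constants, so `k = 1` attains `γ`.

Probabilistic half: the sum of the `U t ^ 2` has a computable exponential moment. Integrating out
the last innovation turns `exp (c * U ^ 2)` into a Gaussian factor of the same kind one step
earlier, and a fixed-point choice of parameters keeps `c` unchanged (`lintegral_exp`). Chernoff's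
bound then gives both tails of the sum. The truncation at 1 is what makes the lower tail of the sum
manageable, since overestimation by `1 + ε` can only occur if `γ * (1 + ε) < 1`. -/

/-! ### Spectral bounds for self-adjoint operators from convergence on a dense set. -/

/-- Self-adjointness and Cauchy–Schwarz give `‖R ^ k f‖ ^ 2 ≤ ‖R ^ (2 * k) f‖ * ‖f‖`. If `‖R f‖ = q
* ‖f‖` with `q > r`, repeated doubling forces growth at least `q ^ (2 ^ m)`, against the assumed
rate. Only the rate matters, so `C` may depend on `f`. -/
theorem norm_apply_le_of_norm_pow_apply_le {H : Type*} [NormedAddCommGroup H]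
    [InnerProductSpace ℂ H] [CompleteSpace H] {R : H →L[ℂ] H} (hR : IsSelfAdjoint R) {r C : ℝ}
    (hr : 0 ≤ r) {f : H} (h : ∀ k : ℕ, ‖(R ^ k) f‖ ≤ C * r ^ k) : ‖R f‖ ≤ r * ‖f‖ := by
  by_contra! hlt
  have hf : 0 < ‖f‖ := by
    rw [norm_pos_iff]
    rintro rfl
    simp at hlt
  set q := ‖R f‖ / ‖f‖ with hq
  have hrq : r < q := by rwa [hq, lt_div_iff₀ hf]
  have hq0 : 0 < q := hr.trans_lt hrq
  have hsq : ∀ k : ℕ, ‖(R ^ k) f‖ ^ 2 ≤ ‖(R ^ (2 * k)) f‖ * ‖f‖ := by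
    intro k
    have hk : (ContinuousLinearMap.adjoint (R ^ k)) = R ^ k := (hR.pow k).adjoint_eq
    have h1 : inner ℂ ((R ^ k) f) ((R ^ k) f) = inner ℂ ((R ^ (2 * k)) f) f := by
      rw [← ContinuousLinearMap.adjoint_inner_left, hk, two_mul, pow_add]
      rfl
    have h2 := norm_inner_le_norm (𝕜 := ℂ) ((R ^ (2 * k)) f) f
    rwa [← h1, inner_self_eq_norm_sq_to_K, norm_pow, RCLike.norm_ofReal, abs_norm] at h2
  have hpow : ∀ m : ℕ, q ^ (2 ^ m) * ‖f‖ ≤ ‖(R ^ (2 ^ m)) f‖ := by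
    intro m
    induction m with
    | zero => simp [hq, div_mul_cancel₀ _ hf.ne']
    | succ m ih =>
      have h1 := hsq (2 ^ m)
      have h2 : (q ^ (2 ^ m) * ‖f‖) ^ 2 ≤ ‖(R ^ (2 ^ m)) f‖ ^ 2 := by gcongr
      rw [pow_succ' 2 m]
      refine le_of_mul_le_mul_right ?_ hf
      calc q ^ (2 * 2 ^ m) * ‖f‖ * ‖f‖ = (q ^ (2 ^ m) * ‖f‖) ^ 2 := by ring
        _ ≤ _ := h2.trans h1
  have hb : ∀ m : ℕ, ‖f‖ ≤ C * (r / q) ^ (2 ^ m) := by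
    intro m
    have h1 := (hpow m).trans (h (2 ^ m))
    rw [div_pow, ← mul_div_assoc, le_div_iff₀ (by positivity)]
    linarith
  have hlim : Filter.Tendsto (fun m : ℕ => C * (r / q) ^ (2 ^ m)) Filter.atTop (nhds (C * 0)) :=
    ((tendsto_pow_atTop_nhds_zero_of_lt_one (by positivity)
      ((div_lt_one hq0).2 hrq)).comp (tendsto_pow_atTop_atTop_of_one_lt (by norm_num))).const_mul C
  have := ge_of_tendsto' hlim hb
  linarith

/-- With `Q` the projection onto the fixed vector `e`, the operator `R = S - Q` satisfies `S * S = R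
^ 2 + Q`, and the previous lemma and density give `‖R‖ ≤ r`. -/
theorem le_sq_of_mem_spectrum_mul_self {H : Type*} [NormedAddCommGroup H]
    [InnerProductSpace ℂ H] [CompleteSpace H] {S : H →L[ℂ] H} (hS : IsSelfAdjoint S) {e : H}
    (he : ‖e‖ = 1) (hSe : S e = e) {r : ℝ} (hr : 0 ≤ r) {D : Set H} (hD : Dense D)
    (h : ∀ f ∈ D, ∃ C : ℝ, ∀ k : ℕ, ‖(S ^ k) f - (inner ℂ e f : ℂ) • e‖ ≤ C * r ^ k)
    {x : ℝ} (hx : (x : ℂ) ∈ spectrum ℂ (S * S)) (hx1 : x ≠ 1) : x ≤ r ^ 2 := by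
  set Q : H →L[ℂ] H := InnerProductSpace.rankOne ℂ e e with hQ
  have hQf : ∀ f, Q f = (inner ℂ e f : ℂ) • e := fun f => by simp [hQ]
  have hQsa : IsSelfAdjoint Q := (InnerProductSpace.isStarProjection_rankOne_self he).isSelfAdjoint
  have hQQ : Q * Q = Q := (InnerProductSpace.isStarProjection_rankOne_self he).isIdempotentElem
  have hSQ : S * Q = Q := by
    ext f
    simp [hQf, hSe]
  have hQS : Q * S = Q := by
    have := congrArg star hSQ
    rwa [star_mul, hQsa.star_eq, hS.star_eq] at this
  set R := S - Q with hR
  have hRsa : IsSelfAdjoint R := hS.sub hQsa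
  have hQSk : ∀ k : ℕ, Q * S ^ k = Q := by
    intro k
    induction k with
    | zero => simp
    | succ k ih => rw [pow_succ, ← mul_assoc, ih, hQS]
  have hRk : ∀ k : ℕ, R ^ (k + 1) = S ^ (k + 1) - Q := by
    intro k
    induction k with
    | zero => simp [hR]
    | succ k ih =>
      rw [pow_succ', ih, hR, sub_mul, mul_sub, mul_sub, hSQ, hQSk, hQQ, ← pow_succ']
      abel
  have hRD : ∀ f, ‖R f‖ ≤ r * ‖f‖ := by
    intro f
    have hcl : IsClosed {f | ‖R f‖ ≤ r * ‖f‖} :=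
      isClosed_le (by fun_prop) (by fun_prop)
    refine hcl.closure_subset_iff.2 (fun g hg => ?_) (hD f)
    obtain ⟨C, hC⟩ := h g hg
    -- The maximum covers `k = 0`, where `R ^ k = S ^ k - Q` fails.
    refine norm_apply_le_of_norm_pow_apply_le hRsa hr (C := max C ‖g‖) fun k => ?_
    cases k with
    | zero => simp
    | succ k =>
      rw [hRk]
      calc ‖(S ^ (k + 1) - Q) g‖ = ‖(S ^ (k + 1)) g - (inner ℂ e g : ℂ) • e‖ := by simp [hQf]
        _ ≤ C * r ^ (k + 1) := hC _
        _ ≤ _ := by gcongr; exact le_max_left _ _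
  have hRn : ‖R‖ ≤ r := R.opNorm_le_bound hr hRD
  by_contra! hlt
  have hx0 : 0 < x := (sq_nonneg r).trans_lt hlt
  have hxc : (x : ℂ) ≠ 0 := by exact_mod_cast hx0.ne'
  have hxc1 : (x : ℂ) - 1 ≠ 0 := sub_ne_zero.2 (by exact_mod_cast hx1)
  refine hx ?_
  change IsUnit (algebraMap ℂ (H →L[ℂ] H) x - S * S)
  have hu1 : IsUnit (algebraMap ℂ (H →L[ℂ] H) x - R ^ 2) := by
    have : (x : ℂ) ∈ resolventSet ℂ (R ^ 2) := by
      have hle : ‖R ^ 2‖ * ‖(1 : H →L[ℂ] H)‖ < ‖(x : ℂ)‖ := by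
        calc ‖R ^ 2‖ * ‖(1 : H →L[ℂ] H)‖ ≤ r ^ 2 * 1 := by
              gcongr
              · exact (norm_pow_le' R (by norm_num)).trans (by gcongr)
              · exact ContinuousLinearMap.norm_id_le
          _ < _ := by simpa [abs_of_pos hx0] using hlt
      exact spectrum.mem_resolventSet_of_norm_lt_mul hle
    exact this
  have hu2 : IsUnit (1 - (x : ℂ)⁻¹ • Q) := by
    refine isUnit_iff_exists.2 ⟨1 + ((x : ℂ) - 1)⁻¹ • Q, ?_, ?_⟩
    all_goals
      simp only [mul_add, add_mul, sub_mul, mul_sub, one_mul, mul_one, smul_mul_assoc,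
        mul_smul_comm, hQQ]
      match_scalars
      · ring
      · field_simp
        ring
  have hRQ : R ^ 2 * Q = 0 := by
    rw [hRk 1, sub_mul, hQQ, pow_two, mul_assoc, hSQ, hSQ, sub_self]
  -- The first factor is invertible because `‖R ^ 2‖ ≤ r ^ 2 < x`, the second because `Q` is
  -- idempotent and `x ≠ 1`.
  have : algebraMap ℂ (H →L[ℂ] H) x - S * S
      = (algebraMap ℂ (H →L[ℂ] H) x - R ^ 2) * (1 - (x : ℂ)⁻¹ • Q) := by
    rw [mul_sub, mul_one, mul_smul_comm, sub_mul, hRQ, sub_zero, Algebra.algebraMap_eq_smul_one,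
      smul_mul_assoc, one_mul, smul_smul, inv_mul_cancel₀ hxc, one_smul, hRk 1, ← pow_two]
    abel
  rw [this]
  exact hu1.mul hu2

/-! ### The invariant law of the AR(1) kernel. -/

namespace AR1

theorem kernel_apply (a x : ℝ) : kernel a x = gaussianReal (a * x) 1 := rfl

theorem bind_kernel_eq_conv (a : ℝ) (ν : Measure ℝ) [SFinite ν] :
    ν.bind (kernel a) = (ν.map (fun x => a * x)).conv (gaussianReal 0 1) := by
  ext s hs
  rw [Measure.bind_apply hs (kernel a).aemeasurable, ← lintegral_indicator_one hs,
    Measure.lintegral_conv (by measurability), lintegral_map _ (by fun_prop)]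
  · refine lintegral_congr fun x => ?_
    have h : gaussianReal (a * x) 1 = (gaussianReal 0 1).map (fun z => a * x + z) := by
      rw [gaussianReal_map_const_add, zero_add]
    rw [kernel_apply, h, ← lintegral_indicator_one hs, lintegral_map _ (by fun_prop)]
    exact measurable_one.indicator hs
  · refine Measurable.lintegral_prod_right' (f := fun p : ℝ × ℝ => s.indicator 1 (p.1 + p.2)) ?_
    exact (measurable_one.indicator hs).comp (by fun_prop)

/-- The variance of the stationary law of the AR(1) chain. -/
noncomputable def stationaryVar (a : ℝ) : NNReal := Real.toNNReal (1 / (1 - a ^ 2))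

theorem one_sub_sq_pos {a : ℝ} (ha₁ : -1 < a) (ha₂ : a < 1) : 0 < 1 - a ^ 2 := by
  nlinarith

theorem coe_stationaryVar {a : ℝ} (ha₁ : -1 < a) (ha₂ : a < 1) :
    (stationaryVar a : ℝ) = 1 / (1 - a ^ 2) :=
  Real.coe_toNNReal _ (one_div_pos.2 (one_sub_sq_pos ha₁ ha₂)).le

theorem stationaryVar_ne_zero {a : ℝ} (ha₁ : -1 < a) (ha₂ : a < 1) : stationaryVar a ≠ 0 := by
  rw [← NNReal.coe_ne_zero, coe_stationaryVar ha₁ ha₂]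
  exact (one_div_pos.2 (one_sub_sq_pos ha₁ ha₂)).ne'

/-- Invariance is a functional equation for the characteristic function, which `G` also solves
without vanishing. The quotient is thus unchanged under `t ↦ a * t`; iterating to 0 and using
continuity, it is constantly 1. -/
theorem eq_gaussianReal_of_invariant {a : ℝ} (ha₁ : -1 < a) (ha₂ : a < 1) {π : Measure ℝ}
    [IsProbabilityMeasure π] (hπ : (kernel a).Invariant π) :
    π = gaussianReal 0 (stationaryVar a) := by
  have hγ := one_sub_sq_pos ha₁ ha₂
  have hφ : ∀ t : ℝ, charFun π t = charFun π (a * t) * charFun (gaussianReal 0 1) t := by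
    intro t
    have : IsProbabilityMeasure (π.map fun x => a * x) :=
      Measure.isProbabilityMeasure_map (by fun_prop)
    conv_lhs => rw [← hπ.def, bind_kernel_eq_conv, charFun_conv, charFun_map_mul]
  set G : ℝ → ℂ := charFun (gaussianReal 0 (stationaryVar a)) with hG
  have hG0 : ∀ t, G t ≠ 0 := fun t => by
    rw [hG, charFun_gaussianReal]
    exact Complex.exp_ne_zero _
  have hGrec : ∀ t : ℝ, G t = G (a * t) * charFun (gaussianReal 0 1) t := by
    intro t
    simp only [hG, charFun_gaussianReal, ← Complex.exp_add]
    congr 1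
    have h1 : ((stationaryVar a : ℝ) : ℂ) = 1 / (1 - a ^ 2) := by
      rw [coe_stationaryVar ha₁ ha₂]
      push_cast
      rfl
    have h2 : (1 - a ^ 2 : ℂ) ≠ 0 := by exact_mod_cast hγ.ne'
    rw [h1]
    push_cast
    field_simp
    ring
  have hstep : ∀ t : ℝ, charFun π t / G t = charFun π (a * t) / G (a * t) := by
    intro t
    have hg : charFun (gaussianReal 0 1) t ≠ 0 := by
      rw [charFun_gaussianReal]
      exact Complex.exp_ne_zero _
    rw [hφ, hGrec, mul_div_mul_right _ _ hg]
  have hiter : ∀ (t : ℝ) (k : ℕ),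
      charFun π t / G t = charFun π (a ^ k * t) / G (a ^ k * t) := by
    intro t k
    induction k with
    | zero => simp
    | succ k ih => rw [ih, hstep (a ^ k * t), ← mul_assoc, ← pow_succ']
  refine Measure.ext_of_charFun (funext fun t => ?_)
  have hcont : Continuous fun t => charFun π t / G t :=
    continuous_charFun.div₀ continuous_charFun hG0
  have hlim : Filter.Tendsto (fun k : ℕ => a ^ k * t) Filter.atTop (nhds 0) := by
    simpa using (tendsto_pow_atTop_nhds_zero_of_abs_lt_one (abs_lt.2 ⟨ha₁, ha₂⟩)).mul_const t
  have h1 : charFun π t / G t = 1 := by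
    have h2 := (hcont.tendsto 0).comp hlim
    have h3 : charFun π (0 : ℝ) / G 0 = 1 := by simp [hG]
    rw [h3] at h2
    refine tendsto_nhds_unique (tendsto_const_nhds.congr fun k => ?_) h2
    exact hiter t k
  exact (div_eq_one_iff_eq (hG0 t)).1 h1

end AR1

/-! ### Reversibility and self-adjointness. -/

namespace MarkovL2

variable {α : Type*} [MeasurableSpace α]

theorem coeFn_markovOp (P : Kernel α α) [IsMarkovKernel P] {π : Measure α} (hπ : P.Invariant π)
    (f : Lp ℂ 2 π) : markovOp P π hπ f =ᵐ[π] fun u => ∫ v, f v ∂(P u) :=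
  MemLp.coeFn_toLp (memLp_integral P hπ f)

theorem markovOp_ae_eq (P : Kernel α α) [IsMarkovKernel P] {π : Measure α} (hπ : P.Invariant π)
    {f : Lp ℂ 2 π} {F : α → ℂ} (hf : f =ᵐ[π] F) :
    markovOp P π hπ f =ᵐ[π] fun u => ∫ v, F v ∂(P u) := by
  filter_upwards [coeFn_markovOp P hπ f, ae_ae_of_ae P hπ hf] with u hu hfu
  rw [hu, integral_congr_ae hfu]

theorem isSelfAdjoint_markovOp (P : Kernel α α) [IsMarkovKernel P] {π : Measure α}
    [IsProbabilityMeasure π] (hπ : P.Invariant π)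
    (hrev : (π ⊗ₘ P).map Prod.swap = π ⊗ₘ P) : IsSelfAdjoint (markovOp P π hπ) := by
  have hfst : MeasurePreserving Prod.fst (π ⊗ₘ P) π := ⟨measurable_fst, Measure.fst_compProd π P⟩
  have hsnd : MeasurePreserving Prod.snd (π ⊗ₘ P) π := by
    refine ⟨measurable_snd, ?_⟩
    change (π ⊗ₘ P).snd = π
    rw [Measure.snd_compProd]
    exact hπ.def
  have hint : ∀ f g : Lp ℂ 2 π,
      Integrable (fun p : α × α => inner ℂ (f p.1) (g p.2)) (π ⊗ₘ P) := by
    intro f g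
    have hf : MemLp (fun p : α × α => star (f p.1)) 2 (π ⊗ₘ P) :=
      ((Lp.memLp f).comp_measurePreserving hfst).star
    have hg : MemLp (fun p : α × α => g p.2) 2 (π ⊗ₘ P) :=
      (Lp.memLp g).comp_measurePreserving hsnd
    exact (hg.integrable_mul hf)
  have hright : ∀ f g : Lp ℂ 2 π, inner ℂ f (markovOp P π hπ g)
      = ∫ p, inner ℂ (f p.1) (g p.2) ∂(π ⊗ₘ P) := by
    intro f g
    rw [Measure.integral_compProd (hint f g), L2.inner_def]
    refine integral_congr_ae ?_
    filter_upwards [coeFn_markovOp P hπ g, ae_integrable P hπ g] with u hu hgu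
    rw [hu]
    exact (integral_inner hgu (f u)).symm
  rw [ContinuousLinearMap.isSelfAdjoint_iff_isSymmetric]
  intro f g
  change inner ℂ (markovOp P π hπ f) g = inner ℂ f (markovOp P π hπ g)
  rw [← inner_conj_symm, hright, hright, ← integral_conj]
  conv_rhs => rw [← hrev]
  rw [integral_map measurable_swap.aemeasurable]
  · exact integral_congr_ae (ae_of_all _ fun p => inner_conj_symm _ _)
  · rw [hrev]
    exact (hint f g).aestronglyMeasurable

end MarkovL2

namespace AR1

/-- Detailed balance: the exponent of the joint density is proportional to `(1 - a ^ 2) * x ^ 2 + (y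
- a * x) ^ 2 = x ^ 2 + y ^ 2 - 2 * a * x * y`, symmetric in `x` and `y`. -/
theorem map_swap_compProd_kernel {a : ℝ} (ha₁ : -1 < a) (ha₂ : a < 1) :
    (gaussianReal 0 (stationaryVar a) ⊗ₘ kernel a).map Prod.swap
      = gaussianReal 0 (stationaryVar a) ⊗ₘ kernel a := by
  have hγ := one_sub_sq_pos ha₁ ha₂
  have hv := stationaryVar_ne_zero ha₁ ha₂
  have hdens : ∀ F : ℝ × ℝ → ENNReal, Measurable F →
      ∫⁻ p, F p ∂(gaussianReal 0 (stationaryVar a) ⊗ₘ kernel a)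
        = ∫⁻ x, ∫⁻ y, gaussianPDF 0 (stationaryVar a) x * gaussianPDF (a * x) 1 y * F (x, y) := by
    intro F hF
    rw [Measure.lintegral_compProd hF, gaussianReal_of_var_ne_zero 0 hv,
      lintegral_withDensity_eq_lintegral_mul₀ (by fun_prop)
        (Measurable.lintegral_kernel_prod_right' hF).aemeasurable]
    refine lintegral_congr fun x => ?_
    rw [Pi.mul_apply, kernel_apply, gaussianReal_of_var_ne_zero (a * x) one_ne_zero,
      lintegral_withDensity_eq_lintegral_mul₀ (by fun_prop) (by fun_prop),
      ← lintegral_const_mul _ (by fun_prop)]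
    refine lintegral_congr fun y => ?_
    rw [Pi.mul_apply, mul_assoc]
  have hsymm : ∀ x y : ℝ, gaussianPDF 0 (stationaryVar a) x * gaussianPDF (a * x) 1 y
      = gaussianPDF 0 (stationaryVar a) y * gaussianPDF (a * y) 1 x := by
    intro x y
    simp only [gaussianPDF]
    rw [← ENNReal.ofReal_mul (gaussianPDFReal_nonneg _ _ _),
      ← ENNReal.ofReal_mul (gaussianPDFReal_nonneg _ _ _)]
    congr 1
    simp only [gaussianPDFReal, coe_stationaryVar ha₁ ha₂]
    rw [mul_mul_mul_comm, mul_mul_mul_comm _ (Real.exp _) _ (Real.exp _), ← Real.exp_add,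
      ← Real.exp_add]
    congr 2
    push_cast
    field_simp
    ring
  refine Measure.ext_of_lintegral _ fun F hF => ?_
  rw [lintegral_map hF measurable_swap, hdens (fun p => F p.swap) (hF.comp measurable_swap),
    hdens _ hF,
    lintegral_lintegral_swap]
  · simp only [Prod.swap_prod_mk]
    refine lintegral_congr fun x => lintegral_congr fun y => ?_
    rw [hsymm]
  · have h1 : Measurable fun p : ℝ × ℝ => gaussianPDF (a * p.1) 1 p.2 :=
      measurable_uncurry_gaussianPDF.comp
        (by fun_prop : Measurable fun p : ℝ × ℝ => (a * p.1, (1 : NNReal), p.2))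
    have h2 : Measurable fun p : ℝ × ℝ => F (Prod.swap (p.1, p.2)) :=
      hF.comp measurable_swap
    have h3 : Measurable fun p : ℝ × ℝ => gaussianPDF 0 (stationaryVar a) p.1 :=
      (measurable_gaussianPDF _ _).comp measurable_fst
    exact ((h3.mul h1).mul h2).aemeasurable

end AR1

/-! ### Computation of the pseudo-spectral gap. -/

namespace AR1

theorem memLp_gaussianReal_of_lipschitz {K : NNReal} {f : ℝ → ℂ} (hf : LipschitzWith K f)
    (m : ℝ) (v : NNReal) : MemLp f 2 (gaussianReal m v) := by
  have hid : MemLp (fun x : ℝ => x) 2 (gaussianReal m v) :=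
    memLp_id_gaussianReal' 2 (by norm_num)
  have h : MemLp (fun x : ℝ => ‖f 0‖ + K * ‖x‖) 2 (gaussianReal m v) :=
    (memLp_const ‖f 0‖).add (hid.norm.const_mul (K : ℝ))
  refine h.mono hf.continuous.aestronglyMeasurable (ae_of_all _ fun x => ?_)
  have h1 : ‖f x - f 0‖ ≤ K * ‖x‖ := by simpa using hf.norm_sub_le x 0
  have h2 : ‖f x‖ ≤ ‖f 0‖ + ‖f x - f 0‖ := norm_le_norm_add_norm_sub' (f x) (f 0)
  rw [Real.norm_of_nonneg (by positivity)]
  linarith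

/-- Synchronous coupling: two chains driven by the same noise have their distance multiplied by
`|a|`. -/
theorem lipschitzWith_integral_kernel (a : ℝ) {K : NNReal} {f : ℝ → ℂ} (hf : LipschitzWith K f) :
    LipschitzWith (K * ‖a‖₊) (fun u => ∫ v, f v ∂(kernel a u)) := by
  have hshift : ∀ u, ∫ v, f v ∂(kernel a u) = ∫ z, f (a * u + z) ∂(gaussianReal 0 1) := by
    intro u
    have h : gaussianReal (a * u) 1 = (gaussianReal 0 1).map (fun z => a * u + z) := by
      rw [gaussianReal_map_const_add, zero_add]
    rw [kernel_apply, h, integral_map (by fun_prop) hf.continuous.aestronglyMeasurable]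
  have hint : ∀ u, Integrable (fun z => f (a * u + z)) (gaussianReal 0 1) := by
    intro u
    refine (memLp_gaussianReal_of_lipschitz (K := K) ?_ 0 1).integrable (by norm_num)
    refine LipschitzWith.of_dist_le_mul fun x y => ?_
    simpa using hf.dist_le_mul (a * u + x) (a * u + y)
  refine LipschitzWith.of_dist_le_mul fun u w => ?_
  rw [hshift, hshift, dist_eq_norm, ← integral_sub (hint u) (hint w)]
  refine (norm_integral_le_of_norm_le_const (C := K * (‖a‖ * dist u w))
    (ae_of_all _ fun z => ?_)).trans ?_
  · refine (hf.norm_sub_le _ _).trans_eq ?_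
    rw [add_sub_add_right_eq_sub, ← mul_sub, norm_mul, dist_eq_norm]
  · simp [mul_assoc]

variable {a : ℝ} {π : Measure ℝ}

theorem exists_lipschitz_markovOp_pow (hπ : (kernel a).Invariant π) {K : NNReal}
    {g : ℝ → ℂ} (hg : LipschitzWith K g) {f : Lp ℂ 2 π} (hf : f =ᵐ[π] g) (k : ℕ) :
    ∃ F : ℝ → ℂ, LipschitzWith (K * ‖a‖₊ ^ k) F ∧
      (MarkovL2.markovOp (kernel a) π hπ ^ k) f =ᵐ[π] F := by
  induction k with
  | zero => exact ⟨g, by simpa using hg, by simpa using hf⟩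
  | succ k ih =>
    obtain ⟨F, hF, hfF⟩ := ih
    refine ⟨_, by simpa [pow_succ, mul_assoc] using lipschitzWith_integral_kernel a hF, ?_⟩
    rw [pow_succ']
    exact MarkovL2.markovOp_ae_eq (kernel a) hπ hfF

theorem pseudoSpectralGap_kernel (ha₁ : -1 < a) (ha₂ : a < 1) [IsProbabilityMeasure π]
    (hπ : (kernel a).Invariant π) :
    MarkovL2.pseudoSpectralGap (kernel a) π hπ = 1 - a ^ 2 := by
  have hγ := one_sub_sq_pos ha₁ ha₂
  have hlaw := eq_gaussianReal_of_invariant ha₁ ha₂ hπ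
  have hv := stationaryVar_ne_zero ha₁ ha₂
  set S := MarkovL2.markovOp (kernel a) π hπ with hS
  have hsa : IsSelfAdjoint S := by
    refine MarkovL2.isSelfAdjoint_markovOp (kernel a) hπ ?_
    rw [hlaw]
    exact map_swap_compProd_kernel ha₁ ha₂
  have hlip : LipschitzWith 1 (fun x : ℝ => (x : ℂ)) :=
    LipschitzWith.of_dist_le_mul fun x y => by
      rw [Complex.dist_eq, ← Complex.ofReal_sub, Complex.norm_real, Real.dist_eq]
      simp
  have hidL : MemLp (fun x : ℝ => (x : ℂ)) 2 π := by
    rw [hlaw]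
    exact memLp_gaussianReal_of_lipschitz hlip _ _
  set ι : Lp ℂ 2 π := hidL.toLp _ with hι
  have hι_coe : ι =ᵐ[π] fun x : ℝ => (x : ℂ) := hidL.coeFn_toLp
  have hι0 : ι ≠ 0 := by
    intro h0
    have h1 : ∀ᵐ x ∂π, x = 0 := by
      filter_upwards [hι_coe, Lp.coeFn_zero ℂ 2 π] with x hx hx0
      rw [h0, hx0, Pi.zero_apply] at hx
      exact_mod_cast hx.symm
    have h2 : ∀ᵐ x ∂π, x ≠ 0 := by
      rw [hlaw]
      have := nullSingletonClass_gaussianReal (μ := 0) hv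
      exact ae_iff.2 (by simp)
    obtain ⟨x, hx1, hx2⟩ := (h1.and h2).exists
    exact hx2 hx1
  have hSι : S ι = (a : ℂ) • ι := by
    refine Lp.ext ?_
    filter_upwards [MarkovL2.markovOp_ae_eq (kernel a) hπ hι_coe, Lp.coeFn_smul (a : ℂ) ι,
      hι_coe] with x h1 h2 h3
    rw [h1, h2, Pi.smul_apply, h3, integral_complex_ofReal, kernel_apply,
      integral_id_gaussianReal]
    simp
  have hSkι : ∀ k : ℕ, (S ^ k) ι = ((a : ℂ) ^ k) • ι := by
    intro k
    induction k with
    | zero => simp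
    | succ k ih =>
      rw [pow_succ']
      change S ((S ^ k) ι) = _
      rw [ih, map_smul, hSι, smul_smul, pow_succ]
  have hadj : ∀ k : ℕ, ContinuousLinearMap.adjoint S ^ k * S ^ k = S ^ k * S ^ k := by
    intro k
    rw [hsa.adjoint_eq]
  have hmem : ∀ k : ℕ, (((a ^ 2) ^ k : ℝ) : ℂ) ∈ spectrum ℂ (S ^ k * S ^ k) := by
    intro k hu
    change IsUnit (algebraMap ℂ _ _ - S ^ k * S ^ k) at hu
    obtain ⟨b, hb⟩ := hu.exists_left_inv
    have h1 : (algebraMap ℂ (Lp ℂ 2 π →L[ℂ] Lp ℂ 2 π) (((a ^ 2) ^ k : ℝ) : ℂ)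
        - S ^ k * S ^ k) ι = 0 := by
      rw [Algebra.algebraMap_eq_smul_one]
      rw [sub_apply, smul_apply,
        one_apply_eq_self, mul_apply_eq_comp, hSkι, map_smul, hSkι, smul_smul, sub_eq_zero]
      congr 1
      push_cast
      ring
    apply hι0
    have h2 := congrArg (fun T : Lp ℂ 2 π →L[ℂ] Lp ℂ 2 π => T ι) hb
    change b ((algebraMap ℂ (Lp ℂ 2 π →L[ℂ] Lp ℂ 2 π) (((a ^ 2) ^ k : ℝ) : ℂ)
        - S ^ k * S ^ k) ι) = ι at h2
    rw [h1, map_zero] at h2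
    exact h2.symm
  have ha2 : a ^ 2 < 1 := by linarith
  have hgap_le : ∀ k : ℕ, k ≠ 0 →
      MarkovL2.spectralGap (ContinuousLinearMap.adjoint S ^ k * S ^ k) ≤ 1 - (a ^ 2) ^ k := by
    intro k hk
    rw [hadj, MarkovL2.spectralGap]
    refine sub_le_sub_left ?_ 1
    refine le_csSup ?_ ⟨hmem k, ?_⟩
    · refine ⟨‖S ^ k * S ^ k‖ * ‖(1 : Lp ℂ 2 π →L[ℂ] Lp ℂ 2 π)‖, fun x hx => ?_⟩
      refine (le_abs_self x).trans ?_
      simpa using spectrum.norm_le_norm_mul_of_mem hx.1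
    · exact (pow_lt_one₀ (sq_nonneg a) ha2 hk).ne
  have hconst : MemLp (fun _ : ℝ => (1 : ℂ)) 2 π := memLp_const 1
  set e : Lp ℂ 2 π := hconst.toLp _ with he
  have he_coe : e =ᵐ[π] fun _ => (1 : ℂ) := hconst.coeFn_toLp
  have he1 : ‖e‖ = 1 := by
    rw [he, Lp.norm_toLp, eLpNorm_const _ (by norm_num) (NeZero.ne π)]
    simp
  have hSe : S e = e := by
    refine Lp.ext ?_
    filter_upwards [MarkovL2.markovOp_ae_eq (kernel a) hπ he_coe, he_coe] with x h1 h2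
    rw [h1, h2]
    simp
  have hSke : ∀ k : ℕ, (S ^ k) e = e := by
    intro k
    induction k with
    | zero => simp
    | succ k ih =>
      rw [pow_succ]
      change (S ^ k) (S e) = e
      rw [hSe, ih]
  have hcontr : ∀ f ∈ {f : Lp ℂ 2 π | ∃ g : ℝ → ℂ, f =ᵐ[π] g ∧ HasCompactSupport g ∧
      ContDiff ℝ (⊤ : ℕ∞) g}, ∃ C : ℝ, ∀ k : ℕ, ‖(S ^ k) f - (inner ℂ e f : ℂ) • e‖ ≤ C * |a| ^ k := by
    rintro f ⟨g, hfg, hgs, hgd⟩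
    obtain ⟨K, hK⟩ := ContDiff.lipschitzWith_of_hasCompactSupport hgs hgd (by simp)
    refine ⟨2 * (K * ‖ι‖), fun k => ?_⟩
    obtain ⟨F, hF, hSF⟩ := exists_lipschitz_markovOp_pow hπ hK hfg k
    -- Centring at `F 0` makes the Lipschitz bound pointwise against `|x|`. Passing from `F 0` to
    -- the mean then costs the factor 2.
    set h := (S ^ k) f - (F 0) • e with hh
    have hnorm : ‖h‖ ≤ K * |a| ^ k * ‖ι‖ := by
      refine Lp.norm_le_mul_norm_of_ae_le_mul ?_
      filter_upwards [hSF, he_coe, hι_coe, Lp.coeFn_sub ((S ^ k) f) (F 0 • e),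
        Lp.coeFn_smul (F 0) e] with x h1 h2 h3 h4 h5
      rw [hh, h4, Pi.sub_apply, h5, Pi.smul_apply, h1, h2, h3]
      have := hF.norm_sub_le x 0
      simpa using this
    have hinner : (inner ℂ e f : ℂ) = inner ℂ e ((S ^ k) f) := by
      rw [← ContinuousLinearMap.adjoint_inner_left, (hsa.pow k).adjoint_eq, hSke]
    have hdecomp : (S ^ k) f - (inner ℂ e f : ℂ) • e = h - (inner ℂ e h : ℂ) • e := by
      rw [hinner, hh, inner_sub_right, inner_smul_right, inner_self_eq_norm_sq_to_K, he1]
      simp [sub_smul]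
    rw [hdecomp]
    calc ‖h - (inner ℂ e h : ℂ) • e‖ ≤ ‖h‖ + ‖(inner ℂ e h : ℂ)‖ * ‖e‖ := by
          rw [← norm_smul]
          exact norm_sub_le _ _
      _ ≤ ‖h‖ + (‖e‖ * ‖h‖) * ‖e‖ := by
          gcongr
          exact norm_inner_le_norm e h
      _ = 2 * ‖h‖ := by
          rw [he1]
          ring
      _ ≤ 2 * (K * |a| ^ k * ‖ι‖) := by gcongr
      _ = _ := by ring
  have hgap_one : 1 - a ^ 2 ≤
      MarkovL2.spectralGap (ContinuousLinearMap.adjoint S ^ 1 * S ^ 1) := by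
    rw [hadj, MarkovL2.spectralGap]
    refine sub_le_sub_left ?_ 1
    refine csSup_le ⟨a ^ 2, by simpa using hmem 1, ha2.ne⟩ fun x hx => ?_
    have hx1 := hx.1
    rw [pow_one] at hx1
    have := le_sq_of_mem_spectrum_mul_self hsa he1 hSe (abs_nonneg a)
      (Lp.dense_hasCompactSupport_contDiff (by norm_num)) hcontr hx1 hx.2
    rwa [sq_abs] at this
  have hterm : ∀ k : ℕ+, MarkovL2.spectralGap
      (ContinuousLinearMap.adjoint S ^ (k : ℕ) * S ^ (k : ℕ)) / (k : ℝ) ≤ 1 - a ^ 2 := by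
    intro k
    have hk : (0 : ℝ) < (k : ℕ) := by exact_mod_cast k.pos
    rw [div_le_iff₀ hk]
    -- Bernoulli's inequality: `1 - (a ^ 2) ^ k ≤ k * (1 - a ^ 2)`.
    have hb := one_add_mul_le_pow (a := a ^ 2 - 1) (by nlinarith [sq_nonneg a]) (k : ℕ)
    rw [add_sub_cancel] at hb
    have := hgap_le k k.ne_zero
    linarith
  refine le_antisymm (ciSup_le hterm) ?_
  refine le_ciSup_of_le ⟨1 - a ^ 2, Set.forall_mem_range.2 hterm⟩ 1 ?_
  simpa using hgap_one

end AR1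

/-! ### Independence of past and noise, and exponential moments of the sum of squares. -/

theorem ProbabilityTheory.IndepFun.prodMk_indepFun {Ω α β γ : Type*} [MeasurableSpace Ω]
    [MeasurableSpace α] [MeasurableSpace β] [MeasurableSpace γ] {μ : Measure Ω}
    [IsProbabilityMeasure μ] {X : Ω → α} {Y : Ω → β} {W : Ω → γ} (hX : Measurable X)
    (hY : Measurable Y) (hW : Measurable W) (h : IndepFun X (fun ω => (Y ω, W ω)) μ)
    (hYW : IndepFun Y W μ) : IndepFun (fun ω => (X ω, Y ω)) W μ := by
  have hXY : IndepFun X Y μ := h.comp measurable_id measurable_fst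
  rw [indepFun_iff_map_prod_eq_prod_map_map (by fun_prop) (by fun_prop)] at h hYW hXY ⊢
  rw [hXY]
  apply (MeasurableEquiv.prodAssoc (α := α) (β := β) (γ := γ)).map_measurableEquiv_injective
  have := Measure.isProbabilityMeasure_map (μ := μ) hX.aemeasurable
  have := Measure.isProbabilityMeasure_map (μ := μ) hY.aemeasurable
  have := Measure.isProbabilityMeasure_map (μ := μ) hW.aemeasurable
  rw [Measure.prodAssoc_prod, ← hYW, ← h,
    Measure.map_map (MeasurableEquiv.measurable _) (by fun_prop)]
  rfl

theorem ProbabilityTheory.iIndepFun.indepFun_tail {Ω β : Type*} [MeasurableSpace Ω]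
    [MeasurableSpace β] {μ : Measure Ω} {Z : ℕ → Ω → β}
    (hZ : ∀ k, Measurable (Z k)) (h : iIndepFun Z μ) (k : ℕ) :
    IndepFun (Z k) (fun ω (j : ℕ) => Z (k + 1 + j) ω) μ := by
  rw [IndepFun_iff_Indep]
  have hd := indep_iSup_of_disjoint (fun i => (hZ i).comap_le) h.iIndep
    (S := {k}) (T := Set.Ici (k + 1)) (by simp)
  refine indep_of_indep_of_le_left (indep_of_indep_of_le_right hd ?_) ?_
  · rw [MeasurableSpace.pi, MeasurableSpace.comap_iSup]
    refine iSup_le fun j => ?_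
    rw [MeasurableSpace.comap_comp]
    exact le_iSup₂_of_le (k + 1 + j) (by simp) le_rfl
  · exact le_iSup₂_of_le k rfl le_rfl

-- Completing the square: the integrand is a multiple of a Gaussian density of variance `v / (1 - 2
-- * c * v)`.
open Real in
theorem lintegral_exp_mul_sq_gaussianReal (m c : ℝ) {v : NNReal} (hv : v ≠ 0)
    (hc : 2 * c * v < 1) :
    ∫⁻ x, ENNReal.ofReal (exp (c * x ^ 2)) ∂(gaussianReal m v)
      = ENNReal.ofReal ((√(1 - 2 * c * v))⁻¹ * exp (c * m ^ 2 / (1 - 2 * c * v))) := by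
  have hd : 0 < 1 - 2 * c * v := by linarith
  have hv0 : (0 : ℝ) < v := by positivity
  set w : NNReal := ⟨v / (1 - 2 * c * v), by positivity⟩ with hw
  have hw0 : w ≠ 0 := by
    rw [← NNReal.coe_ne_zero]
    exact (div_pos hv0 hd).ne'
  have hwv : (w : ℝ) = v / (1 - 2 * c * v) := rfl
  have key : ∀ x, gaussianPDF m v x * ENNReal.ofReal (exp (c * x ^ 2))
      = ENNReal.ofReal ((√(1 - 2 * c * v))⁻¹ * exp (c * m ^ 2 / (1 - 2 * c * v)))
        * gaussianPDF (m / (1 - 2 * c * v)) w x := by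
    intro x
    rw [gaussianPDF, gaussianPDF, ← ENNReal.ofReal_mul (gaussianPDFReal_nonneg _ _ _),
      ← ENNReal.ofReal_mul (by positivity)]
    congr 1
    simp only [gaussianPDFReal, hwv]
    rw [mul_assoc, ← exp_add, mul_mul_mul_comm, ← exp_add]
    congr 1
    · rw [← mul_inv, ← Real.sqrt_mul hd.le]
      congr 2
      rw [mul_div_assoc', mul_div_assoc', mul_div_cancel_left₀ _ hd.ne']
    · congr 1
      obtain ⟨d, hdef⟩ : ∃ d, d = 1 - 2 * c * v := ⟨_, rfl⟩
      rw [← hdef] at hd ⊢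
      obtain rfl : c = (1 - d) / (2 * v) := by
        rw [hdef]
        field_simp
        ring
      field_simp
      ring
  rw [gaussianReal_of_var_ne_zero m hv,
    lintegral_withDensity_eq_lintegral_mul₀ (by fun_prop) (by fun_prop)]
  simp only [Pi.mul_apply, key]
  rw [lintegral_const_mul _ (by fun_prop), lintegral_gaussianPDF_eq_one _ hw0, mul_one]

namespace AR1

variable {Ω : Type*} [MeasurableSpace Ω] {μ : Measure Ω} [IsProbabilityMeasure μ] {a : ℝ}
  {π : Measure ℝ} {U ζ : ℕ → Ω → ℝ}

namespace IsChain

/-- Only `ζ (k + 2)` is needed later, but the induction must carry the whole future noise: each step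
moves one innovation from the future to the past. -/
theorem indepFun_tail (hU : IsChain μ a π U ζ) (k : ℕ) :
    IndepFun (fun ω => (∑ j ∈ Finset.range k, U (j + 1) ω ^ 2, U (k + 1) ω))
      (fun ω (j : ℕ) => ζ (k + j + 2) ω) μ := by
  have hZ : ∀ k, Measurable (ζ (k + 2)) := fun k => hU.measurable_noise _ (by omega)
  have hV : ∀ k, Measurable (U (k + 1)) := fun k => hU.measurable_U _ (by omega)
  have hind : iIndepFun (fun k => ζ (k + 2)) μ :=
    hU.indep_noise.precomp (g := fun k : ℕ => (⟨k + 2, by omega⟩ : {t : ℕ // 2 ≤ t}))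
      fun i j hij => by simpa using hij
  induction k with
  | zero =>
    have h := hU.indep_init.comp (φ := fun x : ℝ => ((0 : ℝ), x))
      (ψ := fun (z : {t : ℕ // 2 ≤ t} → ℝ) (j : ℕ) => z ⟨j + 2, by omega⟩)
      (by fun_prop) (by fun_prop)
    convert h using 1
    · ext ω <;> simp
    · ext ω j
      simp
  | succ k ih =>
    have htail : IndepFun (ζ (k + 2)) (fun ω (j : ℕ) => ζ (k + 1 + j + 2) ω) μ :=
      hind.indepFun_tail hZ k
    have hpair : IndepFun (fun ω => (∑ j ∈ Finset.range k, U (j + 1) ω ^ 2, U (k + 1) ω))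
        (fun ω => (ζ (k + 2) ω, fun j : ℕ => ζ (k + 1 + j + 2) ω)) μ := by
      have h := ih.comp (φ := id) (ψ := fun z : ℕ → ℝ => (z 0, fun j => z (j + 1)))
        measurable_id (by fun_prop)
      have heq : (fun ω => (ζ (k + 2) ω, fun j : ℕ => ζ (k + 1 + j + 2) ω))
          = (fun z : ℕ → ℝ => (z 0, fun j => z (j + 1))) ∘ fun ω j => ζ (k + j + 2) ω := by
        funext ω
        refine Prod.ext rfl (funext fun j => ?_)
        change ζ (k + 1 + j + 2) ω = ζ (k + (j + 1) + 2) ω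
        congr 1
        omega
      rw [heq]
      exact h
    have h := (hpair.prodMk_indepFun (by fun_prop) (hZ k)
      (measurable_pi_lambda _ fun j => hZ (k + 1 + j)) htail).comp
        (φ := fun p : (ℝ × ℝ) × ℝ => (p.1.1 + p.1.2 ^ 2, a * p.1.2 + p.2)) (ψ := id)
        (by fun_prop) measurable_id
    refine h.congr ?_ (Filter.EventuallyEq.refl _ _)
    filter_upwards [hU.recursion (k + 1) (by omega)] with ω hω
    simp [Finset.sum_range_succ, hω]

theorem indepFun_noise (hU : IsChain μ a π U ζ) (k : ℕ) :
    IndepFun (fun ω => (∑ j ∈ Finset.range k, U (j + 1) ω ^ 2, U (k + 1) ω)) (ζ (k + 2)) μ :=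
  (hU.indepFun_tail k).comp measurable_id (measurable_pi_apply 0)

theorem map_eq (hU : IsChain μ a π U ζ) (hπ : (kernel a).Invariant π) (k : ℕ) :
    μ.map (U (k + 1)) = π := by
  have hZ : ∀ k, Measurable (ζ (k + 2)) := fun k => hU.measurable_noise _ (by omega)
  have hV : ∀ k, Measurable (U (k + 1)) := fun k => hU.measurable_U _ (by omega)
  induction k with
  | zero => exact hU.law_init
  | succ k ih =>
    have : IsProbabilityMeasure π := ih ▸ Measure.isProbabilityMeasure_map (hV k).aemeasurable
    have hind : IndepFun (fun ω => a * U (k + 1) ω) (ζ (k + 2)) μ :=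
      (hU.indepFun_noise k).comp (φ := fun p : ℝ × ℝ => a * p.2) (by fun_prop) measurable_id
    rw [Measure.map_congr (hU.recursion (k + 1) (by omega))]
    have h := hind.map_add_eq_map_conv_map ((hV k).const_mul a) (hZ k)
    have h2 : μ.map (fun ω => a * U (k + 1) ω) = π.map (fun x => a * x) := by
      rw [← ih, Measure.map_map (by fun_prop) (hV k)]
      rfl
    rw [h2, hU.law_noise _ (by omega), ← bind_kernel_eq_conv, hπ.def] at h
    exact h

/-- Integrating out the newest innovation turns the coefficient `c` of the last square into `a ^ 2 *
c / (1 - 2 * c)` on the previous one. By `hθ`, adding `θ` restores `c`, so each step only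
contributes a factor `(√(1 - 2 * c))⁻¹`. -/
theorem lintegral_exp (hU : IsChain μ a (gaussianReal 0 (stationaryVar a)) U ζ)
    (ha₁ : -1 < a) (ha₂ : a < 1) {c θ : ℝ} (hc : 2 * c < 1)
    (hc' : 2 * c * stationaryVar a < 1) (hθ : θ + a ^ 2 * c / (1 - 2 * c) = c) (k : ℕ) :
    ∫⁻ ω, ENNReal.ofReal (Real.exp (θ * ∑ j ∈ Finset.range k, U (j + 1) ω ^ 2
        + c * U (k + 1) ω ^ 2)) ∂μ
      = ENNReal.ofReal ((√(1 - 2 * c))⁻¹ ^ k * (√(1 - 2 * c * stationaryVar a))⁻¹) := by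
  have hZ : ∀ k, Measurable (ζ (k + 2)) := fun k => hU.measurable_noise _ (by omega)
  have hV : ∀ k, Measurable (U (k + 1)) := fun k => hU.measurable_U _ (by omega)
  induction k with
  | zero =>
    have h := lintegral_exp_mul_sq_gaussianReal 0 c (stationaryVar_ne_zero ha₁ ha₂) hc'
    rw [← hU.law_init, lintegral_map (by fun_prop) (hV 0)] at h
    simpa using h
  | succ k ih =>
    set X : Ω → ℝ × ℝ := fun ω => (∑ j ∈ Finset.range k, U (j + 1) ω ^ 2, U (k + 1) ω) with hX
    have hXm : Measurable X := by fun_prop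
    have hstep : ∀ x : ℝ × ℝ, ∫⁻ z, ENNReal.ofReal (Real.exp (θ * (x.1 + x.2 ^ 2)
        + c * (a * x.2 + z) ^ 2)) ∂(gaussianReal 0 1)
        = ENNReal.ofReal (√(1 - 2 * c))⁻¹ * ENNReal.ofReal (Real.exp (θ * x.1 + c * x.2 ^ 2)) := by
      intro x
      have h := lintegral_exp_mul_sq_gaussianReal (a * x.2) c (v := 1) one_ne_zero (by simpa)
      have hmap : gaussianReal (a * x.2) 1 = (gaussianReal 0 1).map (fun z => a * x.2 + z) := by
        rw [gaussianReal_map_const_add, zero_add]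
      rw [hmap, lintegral_map (by fun_prop) (by fun_prop)] at h
      simp only [Real.exp_add (θ * _), ENNReal.ofReal_mul (Real.exp_nonneg _)]
      rw [lintegral_const_mul _ (by fun_prop), h, ← ENNReal.ofReal_mul (by positivity),
        ← ENNReal.ofReal_mul (by positivity), ← ENNReal.ofReal_mul (by positivity)]
      congr 1
      rw [mul_left_comm, ← Real.exp_add, mul_assoc, ← Real.exp_add]
      simp only [NNReal.coe_one, mul_one]
      congr 2
      have h2 : c * (a * x.2) ^ 2 / (1 - 2 * c) = (a ^ 2 * c / (1 - 2 * c)) * x.2 ^ 2 := by ring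
      rw [h2]
      linear_combination x.2 ^ 2 * hθ
    have hjoint := (indepFun_iff_map_prod_eq_prod_map_map hXm.aemeasurable
      (hZ k).aemeasurable).1 (hU.indepFun_noise k)
    have hFm : Measurable fun p : (ℝ × ℝ) × ℝ => ENNReal.ofReal
        (Real.exp (θ * (p.1.1 + p.1.2 ^ 2) + c * (a * p.1.2 + p.2) ^ 2)) := by fun_prop
    calc ∫⁻ ω, ENNReal.ofReal (Real.exp (θ * ∑ j ∈ Finset.range (k + 1), U (j + 1) ω ^ 2
          + c * U (k + 1 + 1) ω ^ 2)) ∂μ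
        = ∫⁻ ω, ENNReal.ofReal (Real.exp (θ * ((X ω).1 + (X ω).2 ^ 2)
            + c * (a * (X ω).2 + ζ (k + 2) ω) ^ 2)) ∂μ := by
          refine lintegral_congr_ae ?_
          filter_upwards [hU.recursion (k + 1) (by omega)] with ω hω
          simp only [hω, hX, Finset.sum_range_succ]
      _ = ∫⁻ p, ENNReal.ofReal (Real.exp (θ * (p.1.1 + p.1.2 ^ 2) + c * (a * p.1.2 + p.2) ^ 2))
            ∂(μ.map fun ω => (X ω, ζ (k + 2) ω)) := by
          rw [lintegral_map hFm (by fun_prop)]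
      _ = ∫⁻ x, ENNReal.ofReal (√(1 - 2 * c))⁻¹
            * ENNReal.ofReal (Real.exp (θ * x.1 + c * x.2 ^ 2)) ∂(μ.map X) := by
          rw [hjoint, hU.law_noise _ (by omega), lintegral_prod _ hFm.aemeasurable]
          exact lintegral_congr hstep
      _ = _ := by
          rw [lintegral_const_mul _ (by fun_prop), lintegral_map (by fun_prop) hXm]
          simp only [hX]
          rw [ih, ← ENNReal.ofReal_mul (by positivity)]
          congr 1
          ring

end IsChain

end AR1

namespace AR1

variable {Ω : Type*} [MeasurableSpace Ω] {μ : Measure Ω} [IsProbabilityMeasure μ] {a : ℝ}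
  {π : Measure ℝ} {U ζ : ℕ → Ω → ℝ}

theorem inv_sqrt_one_sub_le_exp {p : ℝ} (hp : p < 1) :
    (√(1 - p))⁻¹ ≤ Real.exp (p / (2 * (1 - p))) := by
  have h1 : 0 < 1 - p := by linarith
  have h2 : (1 - p)⁻¹ ≤ Real.exp (p / (1 - p)) := by
    refine le_trans (le_of_eq ?_) (Real.add_one_le_exp _)
    field_simp
    ring
  have h3 : Real.exp (p / (2 * (1 - p))) = √(Real.exp (p / (1 - p))) := by
    rw [← Real.exp_half]
    congr 1
    field_simp
  rw [h3, ← Real.sqrt_inv]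
  exact Real.sqrt_le_sqrt h2

theorem inv_sqrt_one_sub_le_two {p : ℝ} (hp : p ≤ 1 / 2) : (√(1 - p))⁻¹ ≤ 2 := by
  refine inv_le_of_inv_le₀ (by norm_num) (Real.le_sqrt_of_sq_le ?_)
  linarith

namespace IsChain

/-- Here `y = 2 * c * stationaryVar a`, and `θ` is the solution of the fixed-point equation for that
`c`. Its sign is free, so one estimate serves both tails. Cauchy–Schwarz exchanges the weight `c` on
the last square for `θ`, at the price of halving the exponent. -/
theorem lintegral_exp_half_le (hU : IsChain μ a (gaussianReal 0 (stationaryVar a)) U ζ)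
    (ha₁ : -1 < a) (ha₂ : a < 1) (hπ : (kernel a).Invariant (gaussianReal 0 (stationaryVar a)))
    {y θ : ℝ} (hy : |y| ≤ 1 / 2)
    (hθ : θ = (1 - a ^ 2) ^ 2 * y * (1 - y) / (2 * (1 - (1 - a ^ 2) * y))) (k : ℕ) :
    ∫⁻ ω, ENNReal.ofReal (Real.exp (θ / 2 * ∑ j ∈ Finset.range (k + 1), U (j + 1) ω ^ 2)) ∂μ
      ≤ ENNReal.ofReal (3 * Real.exp
          ((k + 1) * ((1 - a ^ 2) * y / (4 * (1 - (1 - a ^ 2) * y))))) := by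
  have hV : ∀ k, Measurable (U (k + 1)) := fun k => hU.measurable_U _ (by omega)
  have hγ := one_sub_sq_pos ha₁ ha₂
  set γ := 1 - a ^ 2 with hγdef
  have hγ1 : γ ≤ 1 := by nlinarith [sq_nonneg a]
  have hv : (stationaryVar a : ℝ) = 1 / γ := coe_stationaryVar ha₁ ha₂
  obtain ⟨hy1, hy2⟩ := abs_le.1 hy
  have hγy : γ * y ≤ 1 / 2 := by nlinarith
  have hγy' : -(1 / 2) ≤ γ * y := by nlinarith
  have hd : 0 < 1 - γ * y := by linarith
  set c := γ * y / 2 with hc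
  have h2c : 2 * c = γ * y := by rw [hc]; ring
  have h2cv : 2 * c * stationaryVar a = y := by
    rw [h2c, hv]
    field_simp
  have hfix : θ + a ^ 2 * c / (1 - 2 * c) = c := by
    have ha : a ^ 2 = 1 - γ := by rw [hγdef]; ring
    rw [h2c, hθ, hc, ha]
    field_simp
    ring
  have hA := hU.lintegral_exp ha₁ ha₂ (c := c) (θ := θ) (by linarith) (by linarith) hfix k
  rw [h2cv, h2c] at hA
  have hdiff : 2 * (θ - c) * stationaryVar a ≤ 1 / 2 := by
    have h1 : 2 * (θ - c) * stationaryVar a = a ^ 2 * -y / (1 - γ * y) := by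
      have : θ - c = -(a ^ 2 * c / (1 - 2 * c)) := by linarith
      rw [this, h2c, hv, hc]
      field_simp
    rw [h1, div_le_iff₀ hd]
    have ha : a ^ 2 = 1 - γ := by rw [hγdef]; ring
    rw [ha]
    nlinarith
  have hB : ∫⁻ ω, ENNReal.ofReal (Real.exp ((θ - c) * U (k + 1) ω ^ 2)) ∂μ
      ≤ ENNReal.ofReal 2 := by
    have h := lintegral_exp_mul_sq_gaussianReal 0 (θ - c) (stationaryVar_ne_zero ha₁ ha₂)
      (by linarith)
    rw [← hU.map_eq hπ k, lintegral_map (by fun_prop) (hV k)] at h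
    rw [h]
    refine ENNReal.ofReal_le_ofReal ?_
    simpa using inv_sqrt_one_sub_le_two hdiff
  have hC : (√(1 - γ * y))⁻¹ ^ k * (√(1 - y))⁻¹
      ≤ Real.exp (k * (γ * y / (2 * (1 - γ * y)))) * 2 := by
    refine mul_le_mul ?_ (inv_sqrt_one_sub_le_two hy2) (by positivity) (by positivity)
    rw [Real.exp_nat_mul]
    gcongr
    exact inv_sqrt_one_sub_le_exp (by linarith)
  have hcs := ENNReal.lintegral_mul_norm_pow_le (μ := μ) (p := 1 / 2) (q := 1 / 2)
    (f := fun ω => ENNReal.ofReal (Real.exp (θ * ∑ j ∈ Finset.range k, U (j + 1) ω ^ 2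
        + c * U (k + 1) ω ^ 2)))
    (g := fun ω => ENNReal.ofReal (Real.exp ((θ - c) * U (k + 1) ω ^ 2)))
    (by fun_prop) (by fun_prop) (by norm_num) (by norm_num) (by norm_num)
  have hpt : ∀ ω, ENNReal.ofReal (Real.exp (θ / 2 * ∑ j ∈ Finset.range (k + 1), U (j + 1) ω ^ 2))
      = ENNReal.ofReal (Real.exp (θ * ∑ j ∈ Finset.range k, U (j + 1) ω ^ 2
        + c * U (k + 1) ω ^ 2)) ^ (1 / 2 : ℝ)
        * ENNReal.ofReal (Real.exp ((θ - c) * U (k + 1) ω ^ 2)) ^ (1 / 2 : ℝ) := by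
    intro ω
    rw [ENNReal.ofReal_rpow_of_pos (Real.exp_pos _), ENNReal.ofReal_rpow_of_pos (Real.exp_pos _),
      ← Real.exp_mul, ← Real.exp_mul, ← ENNReal.ofReal_mul (Real.exp_nonneg _), ← Real.exp_add,
      Finset.sum_range_succ]
    congr 2
    ring
  simp only [hpt]
  refine hcs.trans ?_
  rw [hA]
  calc _ ≤ ENNReal.ofReal (Real.exp (k * (γ * y / (2 * (1 - γ * y)))) * 2) ^ (1 / 2 : ℝ)
        * ENNReal.ofReal 2 ^ (1 / 2 : ℝ) := by gcongr
    _ = ENNReal.ofReal (2 * Real.exp (k * (γ * y / (4 * (1 - γ * y))))) := by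
        rw [ENNReal.ofReal_rpow_of_pos (by positivity), ENNReal.ofReal_rpow_of_pos (by norm_num),
          ← ENNReal.ofReal_mul (by positivity), ← Real.mul_rpow (by positivity) (by norm_num)]
        congr 1
        rw [← Real.sqrt_eq_rpow, mul_assoc, mul_comm, Real.sqrt_mul (by norm_num),
          Real.sqrt_mul_self (by norm_num), ← Real.exp_half]
        congr 2
        field_simp
        ring
    _ ≤ _ := by
        refine ENNReal.ofReal_le_ofReal ?_
        have h1 : -(1 / 4) ≤ γ * y / (4 * (1 - γ * y)) := by
          rw [le_div_iff₀ (by positivity)]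
          linarith
        have h2 : Real.exp (k * (γ * y / (4 * (1 - γ * y))))
            ≤ Real.exp (1 / 4) * Real.exp ((k + 1) * (γ * y / (4 * (1 - γ * y)))) := by
          rw [← Real.exp_add]
          gcongr
          linarith
        -- Replacing `k` by `k + 1` in the exponent costs at most `exp (1 / 4)`, which raises the
        -- constant from 2 to 3.
        have h3 : Real.exp (1 / 4) ≤ 3 / 2 := by
          have h4 : Real.exp (1 / 4) ^ 4 = Real.exp 1 := by
            rw [← Real.exp_nat_mul]
            norm_num
          refine le_of_pow_le_pow_left₀ (n := 4) (by norm_num) (by norm_num) ?_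
          rw [h4]
          linarith [Real.exp_one_lt_d9]
        nlinarith [Real.exp_pos ((k + 1) * (γ * y / (4 * (1 - γ * y))))]

/-- Chernoff's bound. The factor `y` on both sides of the event selects the upper tail for `y > 0`
and the lower tail for `y < 0`. -/
theorem measureReal_sum_sq_le (hU : IsChain μ a (gaussianReal 0 (stationaryVar a)) U ζ)
    (ha₁ : -1 < a) (ha₂ : a < 1) (hπ : (kernel a).Invariant (gaussianReal 0 (stationaryVar a)))
    {y : ℝ} (hy : |y| ≤ 1 / 2) {n : ℕ} (hn : 1 ≤ n) (b : ℝ) :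
    μ.real {ω | y * (n * b / (1 - a ^ 2)) ≤ y * ∑ t ∈ Finset.Icc 1 n, U t ω ^ 2}
      ≤ 3 * Real.exp (n / 4 * ((1 - a ^ 2) * y / (1 - (1 - a ^ 2) * y) * (1 - b * (1 - y)))) := by
  obtain ⟨k, rfl⟩ : ∃ k, n = k + 1 := ⟨n - 1, by omega⟩
  have hγ := one_sub_sq_pos ha₁ ha₂
  have hV : ∀ k, Measurable (U (k + 1)) := fun k => hU.measurable_U _ (by omega)
  have hsum : ∀ ω, ∑ t ∈ Finset.Icc 1 (k + 1), U t ω ^ 2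
      = ∑ j ∈ Finset.range (k + 1), U (j + 1) ω ^ 2 := by
    intro ω
    rw [Finset.range_eq_Ico, Finset.sum_Ico_add' (fun t => U t ω ^ 2) 0 (k + 1) 1]
    rfl
  obtain ⟨θ, hθ⟩ : ∃ θ, θ = (1 - a ^ 2) ^ 2 * y * (1 - y) / (2 * (1 - (1 - a ^ 2) * y)) :=
    ⟨_, rfl⟩
  have hE := hU.lintegral_exp_half_le ha₁ ha₂ hπ hy hθ k
  obtain ⟨hy1, hy2⟩ := abs_le.1 hy
  set γ := 1 - a ^ 2 with hγdef
  have hγ1 : γ ≤ 1 := by nlinarith [sq_nonneg a]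
  have hd : 0 < 1 - γ * y := by nlinarith
  set x : ℝ := (k + 1 : ℕ) * b / γ with hx
  set r : ℝ := γ ^ 2 * (1 - y) / (2 * (1 - γ * y)) with hr
  have hr0 : 0 ≤ r := div_nonneg (mul_nonneg (sq_nonneg _) (by linarith)) (by linarith)
  have hθr : θ = r * y := by
    rw [hθ, hr]
    ring
  have hsub : {ω | y * x ≤ y * ∑ t ∈ Finset.Icc 1 (k + 1), U t ω ^ 2}
      ⊆ {ω | ENNReal.ofReal (Real.exp (θ / 2 * x)) ≤ ENNReal.ofReal
          (Real.exp (θ / 2 * ∑ j ∈ Finset.range (k + 1), U (j + 1) ω ^ 2))} := by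
    intro ω hω
    rw [Set.mem_ofPred_eq, hsum] at hω
    refine ENNReal.ofReal_le_ofReal (Real.exp_le_exp.2 ?_)
    rw [hθr]
    have := mul_le_mul_of_nonneg_left hω (by positivity : 0 ≤ r / 2)
    linarith
  have hM := (mul_meas_ge_le_lintegral₀ (μ := μ) (f := fun ω => ENNReal.ofReal
    (Real.exp (θ / 2 * ∑ j ∈ Finset.range (k + 1), U (j + 1) ω ^ 2))) (by fun_prop)
    (ENNReal.ofReal (Real.exp (θ / 2 * x)))).trans hE
  have hM2 := (mul_le_mul_right (measure_mono (μ := μ) hsub) _).trans hM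
  have hM3 := ENNReal.toReal_mono ENNReal.ofReal_ne_top hM2
  rw [ENNReal.toReal_mul, ENNReal.toReal_ofReal (Real.exp_nonneg _),
    ENNReal.toReal_ofReal (by positivity)] at hM3
  have hexp : (((k + 1 : ℕ) : ℝ)) / 4 * (γ * y / (1 - γ * y) * (1 - b * (1 - y)))
      = (k + 1) * (γ * y / (4 * (1 - γ * y))) - θ / 2 * x := by
    rw [hθ, hx]
    push_cast
    field_simp
    ring
  rw [hexp, Real.exp_sub, ← mul_div_assoc (3 : ℝ), le_div_iff₀ (Real.exp_pos _), mul_comm]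
  exact hM3

end IsChain

end AR1

/-! ### Deviations of the estimator. -/

namespace AR1

variable {Ω : Type*} [MeasurableSpace Ω] {μ : Measure Ω} [IsProbabilityMeasure μ] {a : ℝ}
  {π : Measure ℝ} {U ζ : ℕ → Ω → ℝ}

theorem sum_le_or_le_sum_of_lt_abs_gapEstimator {n : ℕ} (hn : 1 ≤ n) {x : ℕ → ℝ} {γ ε : ℝ}
    (hγ : 0 < γ) (hγ1 : γ ≤ 1) (hε : 0 < ε) (hT : 0 < ∑ t ∈ Finset.Icc 1 n, x t ^ 2)
    (h : ε < |gapEstimator n x / γ - 1|) :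
    (ε < 1 ∧ n * (1 - ε)⁻¹ / γ ≤ ∑ t ∈ Finset.Icc 1 n, x t ^ 2) ∨
      (γ * (1 + ε) ≤ 1 ∧ ∑ t ∈ Finset.Icc 1 n, x t ^ 2 ≤ n * (1 + ε)⁻¹ / γ) := by
  have hn0 : (0 : ℝ) < n := by exact_mod_cast hn
  set T := ∑ t ∈ Finset.Icc 1 n, x t ^ 2 with hTdef
  have hg : gapEstimator n x = min (n / T) 1 := by
    rw [gapEstimator, ← hTdef]
    congr 1
    field_simp
  rw [hg] at h
  rcases lt_abs.1 h with h | h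
  · right
    have h1 : γ * (1 + ε) < min (n / T) 1 := by
      have : 1 + ε < min (n / T) 1 / γ := by linarith
      rwa [lt_div_iff₀ hγ, mul_comm] at this
    obtain ⟨h2, h3⟩ := lt_min_iff.1 h1
    refine ⟨h3.le, ?_⟩
    rw [lt_div_iff₀ hT] at h2
    rw [le_div_iff₀ hγ, ← div_eq_mul_inv, le_div_iff₀ (by positivity)]
    linarith
  · left
    have h1 : min (n / T) 1 < γ * (1 - ε) := by
      have : min (n / T) 1 / γ < 1 - ε := by linarith
      rwa [div_lt_iff₀ hγ, mul_comm] at this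
    have h0 : 0 < min (n / T) 1 := lt_min (by positivity) one_pos
    have hε1 : 0 < 1 - ε := pos_of_mul_pos_right (h0.trans h1) hγ.le
    refine ⟨by linarith, ?_⟩
    rcases min_lt_iff.1 h1 with h2 | h2
    · rw [div_lt_iff₀ hT] at h2
      rw [div_le_iff₀ hγ, ← div_eq_mul_inv, div_le_iff₀ hε1]
      linarith
    · nlinarith

namespace IsChain

theorem measureReal_le_sum_sq_le (hU : IsChain μ a (gaussianReal 0 (stationaryVar a)) U ζ)
    (ha₁ : -1 < a) (ha₂ : a < 1) (hπ : (kernel a).Invariant (gaussianReal 0 (stationaryVar a)))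
    {n : ℕ} (hn : 1 ≤ n) {ε : ℝ} (hε : 0 < ε) (hε1 : ε < 1) :
    μ.real {ω | n * (1 - ε)⁻¹ / (1 - a ^ 2) ≤ ∑ t ∈ Finset.Icc 1 n, U t ω ^ 2}
      ≤ 3 * Real.exp (-(n * ε ^ 2 * (1 - a ^ 2) ^ 3 / 2304)) := by
  -- The gain is governed by `y * ((1 - y) / (1 - ε) - 1) = y * (ε - y) / (1 - ε)`, largest at `y =
  -- ε / 2`.
  have h := hU.measureReal_sum_sq_le ha₁ ha₂ hπ (y := ε / 2)
    (by rw [abs_of_pos (by positivity)]; linarith) hn (1 - ε)⁻¹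
  have hγ := one_sub_sq_pos ha₁ ha₂
  set γ := 1 - a ^ 2 with hγdef
  have hγ1 : γ ≤ 1 := by nlinarith [sq_nonneg a]
  have hn0 : (0 : ℝ) < n := by exact_mod_cast hn
  have hd : 0 < 1 - γ * (ε / 2) := by nlinarith
  have hε' : 0 < 1 - ε := by linarith
  simp only [mul_le_mul_iff_right₀ (half_pos hε)] at h
  refine h.trans ?_
  gcongr
  have h1 : γ * (ε / 2) ≤ γ * (ε / 2) / (1 - γ * (ε / 2)) := by
    rw [le_div_iff₀ hd]
    have : 0 < γ * (ε / 2) := by positivity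
    nlinarith
  have h2 : ε / 2 ≤ -(1 - (1 - ε)⁻¹ * (1 - ε / 2)) := by
    have : -(1 - (1 - ε)⁻¹ * (1 - ε / 2)) = (ε / 2) / (1 - ε) := by
      field_simp
      ring
    rw [this, le_div_iff₀ hε']
    nlinarith
  have h3 := mul_le_mul h1 h2 (by positivity) (by positivity)
  have h4 : γ ^ 3 ≤ γ := by
    calc γ ^ 3 ≤ γ ^ 1 := pow_le_pow_of_le_one hγ.le hγ1 (by norm_num)
      _ = γ := pow_one γ
  have h5 : ε ^ 2 * γ ^ 3 ≤ ε ^ 2 * γ := by gcongr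
  have h6 : ε ^ 2 * γ ^ 3 / 2304 ≤ 1 / 4 * (γ * (ε / 2) / (1 - γ * (ε / 2))
      * -(1 - (1 - ε)⁻¹ * (1 - ε / 2))) := by
    have : 0 < ε ^ 2 * γ := by positivity
    nlinarith
  have h7 := mul_le_mul_of_nonneg_left h6 hn0.le
  linarith

theorem measureReal_sum_sq_le_le (hU : IsChain μ a (gaussianReal 0 (stationaryVar a)) U ζ)
    (ha₁ : -1 < a) (ha₂ : a < 1) (hπ : (kernel a).Invariant (gaussianReal 0 (stationaryVar a)))
    {n : ℕ} (hn : 1 ≤ n) {ε : ℝ} (hε : 0 < ε) (hε1 : (1 - a ^ 2) * (1 + ε) ≤ 1) :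
    μ.real {ω | ∑ t ∈ Finset.Icc 1 n, U t ω ^ 2 ≤ n * (1 + ε)⁻¹ / (1 - a ^ 2)}
      ≤ 3 * Real.exp (-(n * ε ^ 2 * (1 - a ^ 2) ^ 3 / 2304)) := by
  -- Dividing `ε / 2` by `1 + ε` keeps `w ≤ 1 / 2` however large `ε` is.
  obtain ⟨w, hw⟩ : ∃ w, w = ε / (2 * (1 + ε)) := ⟨_, rfl⟩
  have hw0 : 0 < w := by rw [hw]; positivity
  have hw2 : w ≤ 1 / 2 := by
    rw [hw, div_le_iff₀ (by positivity)]
    linarith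
  have h := hU.measureReal_sum_sq_le ha₁ ha₂ hπ (y := -w)
    (by rwa [abs_neg, abs_of_pos hw0]) hn (1 + ε)⁻¹
  have hγ := one_sub_sq_pos ha₁ ha₂
  set γ := 1 - a ^ 2 with hγdef
  have hγ1 : γ ≤ 1 := by nlinarith [sq_nonneg a]
  have hn0 : (0 : ℝ) < n := by exact_mod_cast hn
  simp only [neg_mul, neg_le_neg_iff, mul_le_mul_iff_right₀ hw0] at h
  refine h.trans ?_
  gcongr
  -- This is where `γ * (1 + ε) ≤ 1` enters. It costs one power of `γ` here and another in `h2`,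
  -- whence `γ ^ 3`.
  have hwε : γ * ε / 2 ≤ w := by
    rw [hw, le_div_iff₀ (by positivity)]
    nlinarith
  have h1 : 2 / 3 * (γ * (γ * ε / 2)) ≤ γ * w / (1 + γ * w) := by
    have h0 : 0 < γ * w := by positivity
    have h0' : γ * w ≤ 1 / 2 := by nlinarith
    have : 2 / 3 * (γ * w) ≤ γ * w / (1 + γ * w) := by
      rw [le_div_iff₀ (by positivity)]
      nlinarith
    refine le_trans ?_ this
    gcongr
  have h2 : γ * ε / 2 ≤ 1 - (1 + ε)⁻¹ * (1 + w) := by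
    have hwle : w ≤ ε / 2 := by
      rw [hw]
      gcongr
      linarith
    have : 1 - (1 + ε)⁻¹ * (1 + w) = (ε - w) / (1 + ε) := by
      field_simp
      ring
    rw [this, le_div_iff₀ (by positivity)]
    nlinarith
  have h3 := mul_le_mul h1 h2 (by positivity) (by positivity)
  have h6 : ε ^ 2 * γ ^ 3 / 2304 ≤ 1 / 4 * (γ * w / (1 + γ * w) * (1 - (1 + ε)⁻¹ * (1 + w))) := by
    have : 0 < ε ^ 2 * γ ^ 3 := by positivity
    nlinarith
  have h7 := mul_le_mul_of_nonneg_left h6 hn0.le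
  have h8 : γ * -w / (1 - γ * -w) * (1 - (1 + ε)⁻¹ * (1 - -w))
      = -(γ * w / (1 + γ * w) * (1 - (1 + ε)⁻¹ * (1 + w))) := by
    rw [mul_neg, sub_neg_eq_add, sub_neg_eq_add, neg_div, neg_mul]
  rw [h8]
  linarith

theorem le_measureReal_gapEstimator
    (hU : IsChain μ a (gaussianReal 0 (stationaryVar a)) U ζ)
    (ha₁ : -1 < a) (ha₂ : a < 1) (hπ : (kernel a).Invariant (gaussianReal 0 (stationaryVar a)))
    {n : ℕ} (hn : 1 ≤ n) {ε : ℝ} (hε : 0 < ε) :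
    1 - Real.exp (9 / 4 - n * ε ^ 2 * (1 - a ^ 2) ^ 3 / 2304)
      ≤ μ.real {ω | |gapEstimator n (fun t => U t ω) / (1 - a ^ 2) - 1| ≤ ε} := by
  have hγ := one_sub_sq_pos ha₁ ha₂
  have hγ1 : 1 - a ^ 2 ≤ 1 := by nlinarith [sq_nonneg a]
  set γ := 1 - a ^ 2 with hγdef
  set b := 3 * Real.exp (-(n * ε ^ 2 * γ ^ 3 / 2304)) with hb
  have hb0 : 0 ≤ b := by positivity
  set good := {ω | |gapEstimator n (fun t => U t ω) / γ - 1| ≤ ε} with hgood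
  set A := {ω | ε < 1 ∧ n * (1 - ε)⁻¹ / γ ≤ ∑ t ∈ Finset.Icc 1 n, U t ω ^ 2} with hA
  set B := {ω | γ * (1 + ε) ≤ 1 ∧ ∑ t ∈ Finset.Icc 1 n, U t ω ^ 2 ≤ n * (1 + ε)⁻¹ / γ} with hB
  -- Off this null set the sum is positive, which avoids the convention `1 / 0 = 0` in the
  -- estimator.
  set N := {ω | U 1 ω = 0} with hN
  have hAb : μ.real A ≤ b := by
    by_cases hε1 : ε < 1
    · simpa only [hA, hε1, true_and] using hU.measureReal_le_sum_sq_le ha₁ ha₂ hπ hn hε hε1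
    · simpa only [hA, hε1, false_and, Set.ofPred_false, measureReal_empty] using hb0
  have hBb : μ.real B ≤ b := by
    by_cases hε1 : γ * (1 + ε) ≤ 1
    · simpa only [hB, hε1, true_and] using hU.measureReal_sum_sq_le_le ha₁ ha₂ hπ hn hε hε1
    · simpa only [hB, hε1, false_and, Set.ofPred_false, measureReal_empty] using hb0
  have hN0 : μ.real N = 0 := by
    have := nullSingletonClass_gaussianReal (μ := 0) (stationaryVar_ne_zero ha₁ ha₂)
    have h1 : (μ.map (U 1)) {0} = 0 := by
      rw [hU.law_init]
      exact measure_singleton 0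
    rw [Measure.map_apply (hU.measurable_U 1 le_rfl) (measurableSet_singleton 0)] at h1
    exact (measureReal_eq_zero_iff (by simp)).2 h1
  have hcover : Set.univ ⊆ good ∪ (A ∪ (B ∪ N)) := by
    intro ω _
    by_cases hωg : ω ∈ good
    · exact Or.inl hωg
    · right
      by_cases hω0 : U 1 ω = 0
      · exact Or.inr (Or.inr hω0)
      · have hT : 0 < ∑ t ∈ Finset.Icc 1 n, U t ω ^ 2 :=
          Finset.sum_pos' (fun t _ => sq_nonneg _)
            ⟨1, Finset.mem_Icc.2 ⟨le_rfl, hn⟩, by positivity⟩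
        rcases sum_le_or_le_sum_of_lt_abs_gapEstimator (x := fun t => U t ω) hn hγ hγ1 hε hT
          (not_le.1 hωg) with h | h
        · exact Or.inl h
        · exact Or.inr (Or.inl h)
  have h1 : 1 ≤ μ.real good + (μ.real A + (μ.real B + μ.real N)) := by
    calc (1 : ℝ) = μ.real Set.univ := by simp
      _ ≤ μ.real (good ∪ (A ∪ (B ∪ N))) := measureReal_mono hcover
      _ ≤ _ := by
        refine (measureReal_union_le _ _).trans ?_
        gcongr
        refine (measureReal_union_le _ _).trans ?_
        gcongr
        exact measureReal_union_le _ _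
  -- Two tails, each with constant 3, are absorbed into `exp (9 / 4)`.
  have h6 : 6 ≤ Real.exp (9 / 4) := by
    calc (6 : ℝ) ≤ 2.7 ^ 2 := by norm_num
      _ ≤ Real.exp 1 ^ 2 := by
        gcongr
        linarith [Real.exp_one_gt_d9]
      _ = Real.exp 2 := by
        rw [← Real.exp_nat_mul]
        norm_num
      _ ≤ _ := by
        gcongr
        norm_num
  have h7 : 2 * b ≤ Real.exp (9 / 4 - n * ε ^ 2 * γ ^ 3 / 2304) := by
    rw [sub_eq_add_neg, Real.exp_add, hb]
    nlinarith [Real.exp_pos (-(n * ε ^ 2 * γ ^ 3 / 2304))]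
  linarith

end IsChain

end AR1

theorem mainTheorem6 {Ω : Type*} [MeasurableSpace Ω] (μ : Measure Ω) [IsProbabilityMeasure μ]
    (a : ℝ) (ha₁ : -1 < a) (ha₂ : a < 1)
    (π : Measure ℝ) (hπ : (AR1.kernel a).Invariant π)
    (U ζ : ℕ → Ω → ℝ) (hU : AR1.IsChain μ a π U ζ) (n : ℕ) (hn : 1 ≤ n) :
    0 < MarkovL2.pseudoSpectralGap (AR1.kernel a) π hπ ∧
    (∀ ε : ℝ, 0 < ε →
      1 - Real.exp (9 / 4
          - n * ε ^ 2 * MarkovL2.pseudoSpectralGap (AR1.kernel a) π hπ ^ 3 / 2304)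
        ≤ μ.real {ω | |AR1.gapEstimator n (fun t => U t ω)
            / MarkovL2.pseudoSpectralGap (AR1.kernel a) π hπ - 1| ≤ ε}) ∧
    (∀ δ : ℝ, 0 < δ → δ < 1 →
      1 - δ
        ≤ μ.real {ω | |AR1.gapEstimator n (fun t => U t ω)
            / MarkovL2.pseudoSpectralGap (AR1.kernel a) π hπ - 1|
          ≤ 24 * MarkovL2.pseudoSpectralGap (AR1.kernel a) π hπ ^ (-(3 / 2) : ℝ)
            * Real.sqrt ((9 + 4 * Real.log (1 / δ)) / n)}) := by
  have hprob : IsProbabilityMeasure π := hU.law_init ▸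
    Measure.isProbabilityMeasure_map (hU.measurable_U 1 le_rfl).aemeasurable
  rw [AR1.pseudoSpectralGap_kernel ha₁ ha₂ hπ]
  obtain rfl := AR1.eq_gaussianReal_of_invariant ha₁ ha₂ hπ
  have hγ := AR1.one_sub_sq_pos ha₁ ha₂
  have hmain := fun ε : ℝ => hU.le_measureReal_gapEstimator ha₁ ha₂ hπ hn (ε := ε)
  refine ⟨hγ, hmain, fun δ hδ hδ1 => ?_⟩
  set γ := 1 - a ^ 2
  have hn0 : (0 : ℝ) < n := by exact_mod_cast hn
  have hL : 0 < Real.log (1 / δ) := Real.log_pos ((one_lt_div hδ).2 hδ1)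
  set ε := 24 * γ ^ (-(3 / 2) : ℝ) * Real.sqrt ((9 + 4 * Real.log (1 / δ)) / n) with hε
  have hε0 : 0 < ε := by positivity
  refine le_trans (le_of_eq ?_) (hmain ε hε0)
  have hpow : (γ ^ (-(3 / 2) : ℝ)) ^ 2 * γ ^ 3 = 1 := by
    rw [← Real.rpow_natCast, ← Real.rpow_natCast, ← Real.rpow_mul hγ.le, ← Real.rpow_add hγ]
    norm_num
  -- Since `24 ^ 2 / 2304 = 1 / 4`, this `ε` makes the failure bound exactly `δ`.
  have hexp : 9 / 4 - n * ε ^ 2 * γ ^ 3 / 2304 = Real.log δ := by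
    have h1 : n * ε ^ 2 * γ ^ 3 = 576 * (9 + 4 * Real.log (1 / δ)) := by
      rw [hε, mul_pow, mul_pow, Real.sq_sqrt (by positivity)]
      calc _ = 576 * (n * ((9 + 4 * Real.log (1 / δ)) / n))
            * ((γ ^ (-(3 / 2) : ℝ)) ^ 2 * γ ^ 3) := by ring
        _ = _ := by rw [hpow, mul_one, mul_div_cancel₀ _ hn0.ne']
    rw [h1, one_div, Real.log_inv]
    ring
  rw [hexp, Real.exp_log hδ]
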